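/- Let $Y$ be a real Banach space with closed unit ball $B_Y$ and unit sphere $S_{Y^*}$ of its dual. A *slice* of $B_Y$ is a set $S(y^*,\varepsilon)=\{y\in B_Y : y^*(y)>1-\varepsilon\}$ with $y^*\in S_{Y^*}$ and $\varepsilon>0$; a *finite convex combination of slices* is a set $\sum_{i=1}^n\lambda_i S(y_i^*,\varepsilon_i)$ (Minkowski sum) with $\lambda_i\ge 0$, $\sum_{i=1}^n\lambda_i=1$, $y_i^*\in S_{Y^*}$, $\varepsilon_i>0$. The space $Y$ has - the *local diameter 2 property* (LD2P) if every slice of $B_Y$ has diameter $2$; - the *diameter 2 property* (D2P) if every non-empty relatively weakly open subset of $B_Y$ has diameter $2$; - the *strong diameter 2 property* (SD2P) if every finite convex combination of slices of $B_Y$ has diameter $2$. A closed subspace $X$ of $Y$ is an *almost isometric ideal* (ai-ideal) in $Y$ if for every $\varepsilon>0$ and every finite-dimensional subspace $E$ of $Y$ there is a linear operator $T:E\to X$ such that $Te=e$ for all $e\in E\cap X$ and $(1-\varepsilon)\|e\|\le\|Te\|\le(1+\varepsilon)\|e\|$ for all $e\in E$. **Proposition.** The Banach space $Y$ has the SD2P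 if and only if every separable ai-ideal in $Y$ has the SD2P. Likewise, $Y$ has the D2P if and only if every separable ai-ideal in $Y$ has the D2P, and $Y$ has the LD2P if and only if every separable ai-ideal in $Y$ has the LD2P. -/

import Mathlib

namespace DiamTwo

section

variable {Y : Type*} [NormedAddCommGroup Y] [NormedSpace ℝ Y]

/-- The set `{y ∈ B_Y : f y > 1 - ε}`; it is a slice of the closed unit ball `B_Y` when
`‖f‖ = 1` and `0 < ε`. -/
def slice (f : StrongDual ℝ Y) (ε : ℝ) : Set Y :=
  {y | y ∈ Metric.closedBall (0 : Y) 1 ∧ 1 - ε < f y}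

/-- The Minkowski combination `∑ i, c i • S(f i, ε i)`. -/
def sliceCombination {n : ℕ} (c : Fin n → ℝ) (f : Fin n → StrongDual ℝ Y) (ε : Fin n → ℝ) :
    Set Y :=
  {y | ∃ z : Fin n → Y, (∀ i, z i ∈ slice (f i) (ε i)) ∧ y = ∑ i, c i • z i}

/-- `V` is a relatively weakly open subset of the closed unit ball. -/
def IsRelWeaklyOpen (V : Set Y) : Prop :=
  ∃ U : Set (WeakSpace ℝ Y), IsOpen U ∧
    V = Metric.closedBall (0 : Y) 1 ∩ toWeakSpace ℝ Y ⁻¹' U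

/-- `X` is an almost isometric ideal in `Y`. -/
def IsAIIdeal (X : Submodule ℝ Y) : Prop :=
  ∀ ε : ℝ, 0 < ε → ∀ E : Submodule ℝ Y, FiniteDimensional ℝ E →
    ∃ T : E →ₗ[ℝ] X,
      (∀ e : E, (e : Y) ∈ X → (T e : Y) = (e : Y)) ∧
      (∀ e : E, (1 - ε) * ‖e‖ ≤ ‖T e‖ ∧ ‖T e‖ ≤ (1 + ε) * ‖e‖)

end

section

variable (Y : Type*) [NormedAddCommGroup Y] [NormedSpace ℝ Y]

/-- Local diameter 2 property: every slice of the unit ball has diameter 2. -/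
def LD2P : Prop :=
  ∀ (f : StrongDual ℝ Y) (ε : ℝ), ‖f‖ = 1 → 0 < ε → Metric.diam (slice f ε) = 2

/-- Diameter 2 property: every nonempty relatively weakly open subset of the unit ball has
diameter 2. -/
def D2P : Prop :=
  ∀ V : Set Y, IsRelWeaklyOpen V → V.Nonempty → Metric.diam V = 2

/-- Strong diameter 2 property: every finite convex combination of slices of the unit ball has
diameter 2. -/
def SD2P : Prop :=
  ∀ (n : ℕ) (c : Fin n → ℝ) (f : Fin n → StrongDual ℝ Y) (ε : Fin n → ℝ),
    (∀ i, 0 ≤ c i) → ∑ i, c i = 1 → (∀ i, ‖f i‖ = 1) → (∀ i, 0 < ε i) →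
    Metric.diam (sliceCombination c f ε) = 2

end

end DiamTwo

namespace DiamTwo

open Filter Topology

/-! ### Diameter 2 inside the unit ball -/

section Diameter

/-! A subset of the unit ball has diameter 2 exactly when it contains pairs at distance arbitrarily
close to 2, so it suffices to transport such pairs between `Y` and `X`.

From `Y` to an ai-ideal `X` (separability plays no role): the local operators `T : E → X`, rescaled
to contractions, form a net of maps `R i : Y → X` indexed by finite sets and precisions. Along an
ultrafilter, `lim f (R i y)` extends each functional `f` on `X` to `Y` with the same norm
(`exists_extension`). A slice or weakly open set in `X` thus lifts to one in `Y`; a distant pair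
found there is pushed back into `X` by some `R i` with almost no loss of distance
(`IsAsymptoticRetraction.diam_eq_two`).

From separable ai-ideals to `Y`: every countable set lies in a separable ai-ideal
(`exists_separable_isAIIdeal`), by a Löwenheim–Skolem style closure argument. Choosing the countable
set to norm the given functionals, or to contain a point of the given weakly open set, makes the
restricted set in `X` admissible, and its distant pairs already lie in the original set. -/

theorem diam_eq_two_iff {E : Type*} [NormedAddCommGroup E] {A : Set E} (hA : A ⊆ Metric.closedBall 0 1) :
    Metric.diam A = 2 ↔ ∀ r < (2 : ℝ), ∃ a ∈ A, ∃ b ∈ A, r < ‖a - b‖ := by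
  have hle : Metric.diam A ≤ 2 := by
    refine Metric.diam_le_of_forall_dist_le (by norm_num) fun a ha b hb => ?_
    have h1 := hA ha
    have h2 := hA hb
    rw [mem_closedBall_zero_iff] at h1 h2
    rw [dist_eq_norm]
    linarith [norm_sub_le a b]
  constructor
  · intro h r hr
    by_contra! hcon
    have hm : Metric.diam A ≤ max r 0 :=
      Metric.diam_le_of_forall_dist_le (le_max_right _ _) fun a ha b hb => by
        rw [dist_eq_norm]
        exact (hcon a ha b hb).trans (le_max_left _ _)
    rw [h] at hm
    exact absurd hm (not_le.2 (max_lt hr two_pos))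
  · intro h
    refine hle.antisymm (le_of_forall_lt fun r hr => ?_)
    obtain ⟨a, ha, b, hb, hab⟩ := h r hr
    rw [← dist_eq_norm] at hab
    exact hab.trans_le (Metric.dist_le_diam_of_mem (Metric.isBounded_closedBall.subset hA) ha hb)

variable {E : Type*} [NormedAddCommGroup E] [NormedSpace ℝ E]

theorem slice_subset_closedBall (f : StrongDual ℝ E) (ε : ℝ) :
    slice f ε ⊆ Metric.closedBall 0 1 := fun _ h => h.1

theorem sliceCombination_subset_closedBall {n : ℕ} {c : Fin n → ℝ} (f : Fin n → StrongDual ℝ E)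
    (ε : Fin n → ℝ) (hc : ∀ i, 0 ≤ c i) (hsum : ∑ i, c i = 1) :
    sliceCombination c f ε ⊆ Metric.closedBall 0 1 := by
  rintro _ ⟨z, hz, rfl⟩
  exact (convex_closedBall (0 : E) 1).sum_mem (fun i _ => hc i) hsum fun i _ => (hz i).1

theorem IsRelWeaklyOpen.subset_closedBall {V : Set E} (hV : IsRelWeaklyOpen V) :
    V ⊆ Metric.closedBall 0 1 := by
  obtain ⟨U, -, rfl⟩ := hV
  exact Set.inter_subset_left

theorem diam_eq_two_of_mem_subspace {X : Submodule ℝ E} {A : Set E} {B : Set X}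
    (hA : A ⊆ Metric.closedBall 0 1) (hB : B ⊆ Metric.closedBall 0 1)
    (hBA : ∀ x ∈ B, (x : E) ∈ A) (h : Metric.diam B = 2) : Metric.diam A = 2 := by
  rw [diam_eq_two_iff hB] at h
  refine (diam_eq_two_iff hA).2 fun r hr => ?_
  obtain ⟨a, ha, b, hb, hab⟩ := h r hr
  exact ⟨a, hBA a ha, b, hBA b hb, hab⟩

end Diameter

/-! ### Passing from `Y` to an ai-ideal -/

section Approximation

variable {Y : Type*} [NormedAddCommGroup Y] [NormedSpace ℝ Y]

/-- A net of norm-decreasing maps `Y → X`, asymptotically linear and isometric, and asymptotically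
the identity on `X`. -/
structure IsAsymptoticRetraction (X : Submodule ℝ Y) {ι : Type*} (l : Filter ι)
    (R : ι → Y → X) : Prop where
  norm_le : ∀ i y, ‖R i y‖ ≤ ‖y‖
  add : ∀ y z, ∀ᶠ i in l, R i (y + z) = R i y + R i z
  smul : ∀ (a : ℝ) y, ∀ᶠ i in l, R i (a • y) = a • R i y
  tendsto_norm : ∀ y, Tendsto (fun i => ‖R i y‖) l (𝓝 ‖y‖)
  tendsto_coe : ∀ x : X, Tendsto (fun i => R i x) l (𝓝 x)

/-- The factor `(1 + ε)⁻¹` makes the operator map the unit ball into the unit ball, at the price of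
fixing `X ∩ E` only up to that factor. Extension by zero off `E` gives all the maps the common
domain `Y`. -/
theorem IsAIIdeal.exists_contraction {X : Submodule ℝ Y} (hX : IsAIIdeal X) {ε : ℝ} (hε : 0 < ε)
    (E : Submodule ℝ Y) [FiniteDimensional ℝ E] :
    ∃ r : Y → X, (∀ y, ‖r y‖ ≤ ‖y‖) ∧ (∀ y ∈ E, ∀ z ∈ E, r (y + z) = r y + r z) ∧
      (∀ a : ℝ, ∀ y ∈ E, r (a • y) = a • r y) ∧
      (∀ y ∈ E, (1 + ε)⁻¹ * ((1 - ε) * ‖y‖) ≤ ‖r y‖) ∧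
      ∀ x : X, (x : Y) ∈ E → r x = (1 + ε)⁻¹ • x := by
  classical
  obtain ⟨T, hfix, hnorm⟩ := hX ε hε E inferInstance
  have hc : 0 < (1 + ε)⁻¹ := by positivity
  obtain ⟨r, hr, hr0⟩ : ∃ r : Y → X, (∀ y (h : y ∈ E), r y = (1 + ε)⁻¹ • T ⟨y, h⟩) ∧
      ∀ y, y ∉ E → r y = 0 :=
    ⟨fun y => if h : y ∈ E then (1 + ε)⁻¹ • T ⟨y, h⟩ else 0, fun y h => dif_pos h,
      fun y h => dif_neg h⟩
  refine ⟨r, fun y => ?_, fun y hy z hz => ?_, fun a y hy => ?_, fun y hy => ?_, fun x hx => ?_⟩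
  · by_cases h : y ∈ E
    · rw [hr y h, norm_smul, Real.norm_of_nonneg hc.le, inv_mul_le_iff₀ (by positivity)]
      exact (hnorm ⟨y, h⟩).2
    · rw [hr0 y h, norm_zero]
      exact norm_nonneg y
  · rw [hr y hy, hr z hz, hr _ (add_mem hy hz), ← smul_add, ← map_add, AddMemClass.mk_add_mk]
  · rw [hr y hy, hr _ (E.smul_mem a hy), smul_comm a, ← map_smul T a]
    exact congrArg (fun e => (1 + ε)⁻¹ • T e) (Subtype.ext rfl)
  · rw [hr y hy, norm_smul, Real.norm_of_nonneg hc.le]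
    exact mul_le_mul_of_nonneg_left (hnorm ⟨y, hy⟩).1 hc.le
  · rw [hr x hx]
    exact congrArg _ (Subtype.ext (hfix ⟨x, hx⟩ x.2))

theorem IsAIIdeal.exists_asymptoticRetraction {X : Submodule ℝ Y} (hX : IsAIIdeal X) :
    ∃ R : Finset Y × ℕ → Y → X, IsAsymptoticRetraction X atTop R := by
  classical
  obtain ⟨δ, hδ, hlim⟩ : ∃ δ : Finset Y × ℕ → ℝ, (∀ i, 0 < δ i) ∧ Tendsto δ atTop (𝓝 0) := by
    refine ⟨fun i => 1 / ((i.2 : ℝ) + 1), fun i => Nat.one_div_pos_of_nat,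
      tendsto_one_div_add_atTop_nhds_zero_nat.comp ?_⟩
    rw [← prod_atTop_atTop_eq]
    exact tendsto_snd
  have hclim : Tendsto (fun i => (1 + δ i)⁻¹) atTop (𝓝 1) := by
    have := (hlim.const_add 1).inv₀ (by norm_num)
    rwa [add_zero, inv_one] at this
  have hmem : ∀ y : Y, ∀ᶠ i : Finset Y × ℕ in atTop, y ∈ Submodule.span ℝ (i.1 : Set Y) := by
    intro y
    filter_upwards [eventually_ge_atTop (({y} : Finset Y), 0)] with i hi
    exact Submodule.subset_span (hi.1 (Finset.mem_singleton_self y))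
  choose R hle hadd hsmul hlow hfix using fun i : Finset Y × ℕ =>
    have := FiniteDimensional.span_finset ℝ i.1
    hX.exists_contraction (hδ i) (Submodule.span ℝ (i.1 : Set Y))
  refine ⟨R, hle, fun y z => ?_, fun a y => ?_, fun y => ?_, fun x => ?_⟩
  · filter_upwards [hmem y, hmem z] with i hy hz
    exact hadd i y hy z hz
  · filter_upwards [hmem y] with i hy
    exact hsmul i a y hy
  · have hlim' : Tendsto (fun i => (1 + δ i)⁻¹ * ((1 - δ i) * ‖y‖)) atTop (𝓝 ‖y‖) := by
      have := hclim.mul ((hlim.const_sub 1).mul_const ‖y‖)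
      rwa [sub_zero, one_mul, one_mul] at this
    refine tendsto_of_tendsto_of_tendsto_of_le_of_le' hlim' tendsto_const_nhds ?_
      (Eventually.of_forall fun i => hle i y)
    filter_upwards [hmem y] with i hy
    exact hlow i y hy
  · have : Tendsto (fun i => (1 + δ i)⁻¹ • x) atTop (𝓝 x) := by
      simpa only [one_smul] using hclim.smul_const x
    refine this.congr' ?_
    filter_upwards [hmem x] with i hx
    exact (hfix i x hx).symm

namespace IsAsymptoticRetraction

variable {X : Submodule ℝ Y} {ι : Type*} {R : ι → Y → X}

theorem mono {l l' : Filter ι} (hR : IsAsymptoticRetraction X l R) (h : l' ≤ l) :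
    IsAsymptoticRetraction X l' R where
  norm_le := hR.norm_le
  add y z := h (hR.add y z)
  smul a y := h (hR.smul a y)
  tendsto_norm y := (hR.tendsto_norm y).mono_left h
  tendsto_coe x := (hR.tendsto_coe x).mono_left h

theorem sum_smul {l : Filter ι} (hR : IsAsymptoticRetraction X l R) {κ : Type*} (s : Finset κ)
    (c : κ → ℝ) (z : κ → Y) :
    ∀ᶠ i in l, R i (∑ j ∈ s, c j • z j) = ∑ j ∈ s, c j • R i (z j) := by
  classical
  induction s using Finset.induction_on with
  | empty =>
    filter_upwards [hR.smul 0 0] with i hi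
    simpa using hi
  | insert a s ha ih =>
    filter_upwards [ih, hR.smul (c a) (z a), hR.add (c a • z a) (∑ j ∈ s, c j • z j)]
      with i h1 h2 h3
    rw [Finset.sum_insert ha, Finset.sum_insert ha, h3, h2, h1]

theorem sub {l : Filter ι} (hR : IsAsymptoticRetraction X l R) (y z : Y) :
    ∀ᶠ i in l, R i (y - z) = R i y - R i z := by
  filter_upwards [hR.add (y - z) z] with i h
  rw [sub_add_cancel] at h
  rw [h, add_sub_cancel_right]

/-- Along an ultrafilter, functionals on `X` have norm-preserving extensions `lim f ∘ R i`. -/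
theorem exists_extension {l : Ultrafilter ι} (hR : IsAsymptoticRetraction X l R)
    (f : StrongDual ℝ X) :
    ∃ g : StrongDual ℝ Y, ‖g‖ = ‖f‖ ∧ (∀ x : X, g x = f x) ∧
      ∀ y, Tendsto (fun i => f (R i y)) l (𝓝 (g y)) := by
  have hb : ∀ i y, ‖f (R i y)‖ ≤ ‖f‖ * ‖y‖ := fun i y =>
    (f.le_opNorm _).trans (mul_le_mul_of_nonneg_left (hR.norm_le i y) (norm_nonneg f))
  have hlim : ∀ y, ∃ a : ℝ, ‖a‖ ≤ ‖f‖ * ‖y‖ ∧ Tendsto (fun i => f (R i y)) l (𝓝 a) := by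
    intro y
    -- An ultrafilter on a compact interval converges, so no subnet has to be chosen for each `y`.
    obtain ⟨a, ha, hla⟩ := (isCompact_closedBall (0 : ℝ) (‖f‖ * ‖y‖)).ultrafilter_le_nhds
      (l.map fun i => f (R i y)) (by
        rw [le_principal_iff]
        exact mem_map.2 (Eventually.of_forall fun i => mem_closedBall_zero_iff.2 (hb i y)))
    exact ⟨a, mem_closedBall_zero_iff.1 ha, hla⟩
  choose g hg hlg using hlim
  let g₀ : Y →ₗ[ℝ] ℝ :=
    { toFun := g
      map_add' := fun y z => by
        refine tendsto_nhds_unique (hlg (y + z)) (((hlg y).add (hlg z)).congr' ?_)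
        filter_upwards [hR.add y z] with i hi
        rw [hi, map_add]
      map_smul' := fun a y => by
        refine tendsto_nhds_unique (hlg (a • y)) (((hlg y).const_mul a).congr' ?_)
        filter_upwards [hR.smul a y] with i hi
        rw [hi, map_smul, smul_eq_mul] }
  let G : StrongDual ℝ Y := g₀.mkContinuous ‖f‖ hg
  have hGX : ∀ x : X, G x = f x := fun x =>
    tendsto_nhds_unique (hlg x) ((f.continuous.tendsto x).comp (hR.tendsto_coe x))
  refine ⟨G, le_antisymm (g₀.mkContinuous_norm_le (norm_nonneg f) hg) ?_, hGX, hlg⟩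
  refine f.opNorm_le_bound (norm_nonneg G) fun x => ?_
  rw [← hGX x]
  exact G.le_opNorm x

/-- For a distant pair `a, b` in `A`, the norm of `R i a - R i b = R i (a - b)` tends to `‖a - b‖`,
while both images eventually lie in `B`; one index serves all these conditions. -/
theorem diam_eq_two {l : Filter ι} [l.NeBot] (hR : IsAsymptoticRetraction X l R) {A : Set Y}
    {B : Set X} (hA : A ⊆ Metric.closedBall 0 1) (hB : B ⊆ Metric.closedBall 0 1)
    (hAB : ∀ y ∈ A, ∀ᶠ i in l, R i y ∈ B) (h : Metric.diam A = 2) : Metric.diam B = 2 := by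
  rw [diam_eq_two_iff hA] at h
  refine (diam_eq_two_iff hB).2 fun r hr => ?_
  obtain ⟨a, ha, b, hb, hab⟩ := h r hr
  obtain ⟨i, h1, h2, h3, h4⟩ := ((hAB a ha).and ((hAB b hb).and ((hR.sub a b).and
    ((hR.tendsto_norm (a - b)).eventually_const_lt hab)))).exists
  exact ⟨R i a, h1, R i b, h2, h3 ▸ h4⟩

theorem eventually_mem_slice {l : Filter ι} (hR : IsAsymptoticRetraction X l R)
    {f : StrongDual ℝ X} {g : StrongDual ℝ Y} {ε : ℝ} {y : Y}
    (hfg : Tendsto (fun i => f (R i y)) l (𝓝 (g y))) (hy : y ∈ slice g ε) :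
    ∀ᶠ i in l, R i y ∈ slice f ε := by
  filter_upwards [hfg.eventually_const_lt hy.2] with i hi
  exact ⟨mem_closedBall_zero_iff.2 ((hR.norm_le i y).trans (mem_closedBall_zero_iff.1 hy.1)), hi⟩

end IsAsymptoticRetraction

theorem IsAIIdeal.exists_ultrafilter {X : Submodule ℝ Y} (hX : IsAIIdeal X) :
    ∃ (l : Ultrafilter (Finset Y × ℕ)) (R : Finset Y × ℕ → Y → X),
      IsAsymptoticRetraction X (l : Filter (Finset Y × ℕ)) R := by
  classical
  obtain ⟨R, hR⟩ := hX.exists_asymptoticRetraction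
  exact ⟨Ultrafilter.of atTop, R, hR.mono (Ultrafilter.of_le _)⟩

theorem LD2P.of_isAIIdeal {X : Submodule ℝ Y} (hY : LD2P Y) (hX : IsAIIdeal X) : LD2P X := by
  obtain ⟨l, R, hR⟩ := hX.exists_ultrafilter
  intro f ε hf hε
  obtain ⟨g, hg, -, hlim⟩ := hR.exists_extension f
  exact hR.diam_eq_two (slice_subset_closedBall g ε) (slice_subset_closedBall f ε)
    (fun y hy => hR.eventually_mem_slice (hlim y) hy) (hY g ε (hg.trans hf) hε)

theorem SD2P.of_isAIIdeal {X : Submodule ℝ Y} (hY : SD2P Y) (hX : IsAIIdeal X) : SD2P X := by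
  obtain ⟨l, R, hR⟩ := hX.exists_ultrafilter
  intro n c f ε hc hsum hf hε
  choose g hg _ hlim using fun i => hR.exists_extension (f i)
  refine hR.diam_eq_two (sliceCombination_subset_closedBall g ε hc hsum)
    (sliceCombination_subset_closedBall f ε hc hsum) ?_
    (hY n c g ε hc hsum (fun i => (hg i).trans (hf i)) hε)
  rintro _ ⟨z, hz, rfl⟩
  filter_upwards [hR.sum_smul Finset.univ c z,
    eventually_all.2 fun j => hR.eventually_mem_slice (hlim j (z j)) (hz j)] with i h1 h2
  exact ⟨fun j => R i (z j), h2, h1⟩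

theorem D2P.of_isAIIdeal {X : Submodule ℝ Y} (hY : D2P Y) (hX : IsAIIdeal X) : D2P X := by
  obtain ⟨l, R, hR⟩ := hX.exists_ultrafilter
  intro V hV hne
  have hVball := hV.subset_closedBall
  obtain ⟨U, hU, rfl⟩ := hV
  obtain ⟨x₀, hx₀, hx₀U⟩ := hne
  -- The weak topology is induced by evaluation into the product over all functionals. Extending
  -- every functional on `X` at once lets the same open set `W` define the lifted set `U'` in `Y`,
  -- without reducing to basic neighbourhoods.
  obtain ⟨W, hW, rfl⟩ := isOpen_induced_iff.1 hU
  choose g _ hgX hlim using hR.exists_extension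
  let U' : Set (WeakSpace ℝ Y) := {y | (fun f => g f ((toWeakSpace ℝ Y).symm y)) ∈ W}
  have hU' : IsOpen U' := by
    refine hW.preimage (continuous_pi fun f => ?_)
    exact WeakBilin.eval_continuous (topDualPairing ℝ Y).flip (g f)
  have hV' : IsRelWeaklyOpen (Metric.closedBall (0 : Y) 1 ∩ toWeakSpace ℝ Y ⁻¹' U') :=
    ⟨U', hU', rfl⟩
  refine hR.diam_eq_two hV'.subset_closedBall hVball ?_ (hY _ hV' ⟨x₀, ?_, ?_⟩)
  · rintro y ⟨hy, hyU⟩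
    have ht : Tendsto (fun i => fun f : StrongDual ℝ X => f (R i y)) l (𝓝 fun f => g f y) :=
      tendsto_pi_nhds.2 fun f => hlim f y
    filter_upwards [ht (hW.mem_nhds hyU)] with i hi
    exact ⟨mem_closedBall_zero_iff.2 ((hR.norm_le i y).trans (mem_closedBall_zero_iff.1 hy)), hi⟩
  · exact mem_closedBall_zero_iff.2 (mem_closedBall_zero_iff.1 hx₀)
  · have : (fun f : StrongDual ℝ X => g f x₀) = fun f => f x₀ := funext fun f => hgX f x₀
    change (fun f : StrongDual ℝ X => g f x₀) ∈ W
    rw [this]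
    exact hx₀U

end Approximation

/-! ### Separable ai-ideals and passing back to `Y` -/

section SeparableIdeals

variable {Y : Type*} [NormedAddCommGroup Y] [NormedSpace ℝ Y]

/-- The linear combination of the vectors `b i` and `y j` with coefficients `p`. -/
def combination {m k : ℕ} (b : Fin m → Y) (y : Fin k → Y) (p : (Fin m → ℝ) × (Fin k → ℝ)) : Y :=
  ∑ i, p.1 i • b i + ∑ j, p.2 j • y j

theorem continuous_combination {m k : ℕ} (b : Fin m → Y) (y : Fin k → Y) :
    Continuous (combination b y) := by
  unfold combination
  fun_prop

theorem combination_smul {m k : ℕ} (b : Fin m → Y) (y : Fin k → Y) (a : ℝ)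
    (p : (Fin m → ℝ) × (Fin k → ℝ)) : combination b y (a • p) = a • combination b y p := by
  simp [combination, Finset.smul_sum, mul_smul]

theorem norm_combination_sub_le {m k : ℕ} (b b' : Fin m → Y) (y : Fin k → Y)
    (p : (Fin m → ℝ) × (Fin k → ℝ)) :
    ‖combination b y p - combination b' y p‖ ≤ (∑ i, ‖b i - b' i‖) * ‖p‖ := by
  have : combination b y p - combination b' y p = ∑ i, p.1 i • (b i - b' i) := by
    simp only [combination, smul_sub, Finset.sum_sub_distrib]
    abel
  rw [this, Finset.sum_mul]
  refine norm_sum_le_of_le _ fun i _ => ?_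
  rw [norm_smul, mul_comm]
  exact mul_le_mul_of_nonneg_left ((norm_le_pi_norm p.1 i).trans (norm_fst_le p)) (norm_nonneg _)

/-- Countably many `k`-tuples approximate the norm of every `k`-tuple over `b`. -/
theorem exists_countable_norm_approx {m : ℕ} (b : Fin m → Y) (k : ℕ) :
    ∃ S : Set (Fin k → Y), S.Countable ∧ ∀ e : Fin k → Y, ∀ η : ℝ, 0 < η →
      ∃ y ∈ S, ∀ p, |‖combination b y p‖ - ‖combination b e p‖| ≤ η * ‖p‖ := by
  let K := Metric.closedBall (0 : (Fin m → ℝ) × (Fin k → ℝ)) 1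
  have : CompactSpace K := isCompact_iff_compactSpace.1 (isCompact_closedBall _ _)
  -- A tuple is recorded by its norm function on the compact coefficient ball `K`. Since `C(K, ℝ)`
  -- is a separable metric space, so is the range of `Φ`, even when `Y` is not; homogeneity then
  -- extends the estimate from `K` to all `p`.
  let Φ : (Fin k → Y) → C(K, ℝ) := fun y =>
    ⟨fun p => ‖combination b y p‖, by
      exact ((continuous_combination b y).comp continuous_subtype_val).norm⟩
  obtain ⟨t, ht, htd⟩ := TopologicalSpace.exists_countable_dense (Set.range Φ)
  choose s hs using fun x : Set.range Φ => x.2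
  refine ⟨s '' t, ht.image s, fun e η hη => ?_⟩
  obtain ⟨x, hxt, hx⟩ := htd.exists_dist_lt ⟨Φ e, e, rfl⟩ hη
  refine ⟨s x, ⟨x, hxt, rfl⟩, fun p => ?_⟩
  have hK : ∀ q ∈ K, |‖combination b (s x) q‖ - ‖combination b e q‖| ≤ η := by
    intro q hq
    have h1 : dist (Φ e) x.1 < η := hx
    rw [← hs x, dist_comm] at h1
    exact (ContinuousMap.dist_apply_le_dist (f := Φ (s x)) (g := Φ e) ⟨q, hq⟩).trans h1.le
  rcases eq_or_ne p 0 with rfl | hp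
  · simp [combination]
  have hp' : 0 < ‖p‖ := norm_pos_iff.2 hp
  have hq := hK (‖p‖⁻¹ • p) (by
    rw [mem_closedBall_zero_iff, norm_smul, norm_inv, norm_norm, inv_mul_cancel₀ hp'.ne'])
  rw [combination_smul, combination_smul, norm_smul, norm_smul, norm_inv, norm_norm, ← mul_sub,
    abs_mul, abs_of_pos (inv_pos.2 hp'), inv_mul_le_iff₀ hp', mul_comm] at hq
  exact hq

/-- `B` approximates the span of `A` and the norms of finite tuples of `Y` over `A`. -/
def Approximates (A B : Set Y) : Prop :=
  (Submodule.span ℝ A : Set Y) ⊆ closure B ∧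
    ∀ (m k : ℕ) (b : Fin m → Y), (∀ i, b i ∈ A) → ∀ (e : Fin k → Y) (η : ℝ), 0 < η →
      ∃ y : Fin k → Y, (∀ j, y j ∈ B) ∧
        ∀ p, |‖combination b y p‖ - ‖combination b e p‖| ≤ η * ‖p‖

theorem exists_countable_approximates {A : Set Y} (hA : A.Countable) :
    ∃ B : Set Y, B.Countable ∧ A ⊆ B ∧ Approximates A B := by
  choose S hS hSapprox using
    fun (m k : ℕ) (b : Fin m → Y) => exists_countable_norm_approx b k
  obtain ⟨D, hD, hAD⟩ := hA.isSeparable.span (R := ℝ)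
  have := hA.to_subtype
  let G : Set Y := ⋃ (m : ℕ) (k : ℕ) (b : Fin m → A) (j : Fin k),
    (fun y : Fin k → Y => y j) '' S m k (fun i => b i)
  have hG : G.Countable := by
    refine Set.countable_iUnion fun m => Set.countable_iUnion fun k =>
      Set.countable_iUnion fun b => Set.countable_iUnion fun j => (hS _ _ _).image _
  refine ⟨A ∪ (D ∪ G), hA.union (hD.union hG), Set.subset_union_left, ?_, ?_⟩
  · exact hAD.trans (closure_mono fun x hx => Or.inr (Or.inl hx))
  · intro m k b hb e η hη
    obtain ⟨y, hy, hyp⟩ := hSapprox m k b e η hη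
    refine ⟨y, fun j => Or.inr (Or.inr ?_), hyp⟩
    simp only [G, Set.mem_iUnion]
    exact ⟨m, k, fun i => ⟨b i, hb i⟩, j, y, hy, rfl⟩

/-- Iterate the one-step enlargement and take the union: each instance of the condition involves
finitely many elements, hence lives at a finite stage and is met at the next. -/
theorem exists_countable_approximates_self {A : Set Y} (hA : A.Countable) :
    ∃ B : Set Y, B.Countable ∧ A ⊆ B ∧ Approximates B B := by
  choose F hF hsub happ using fun A : {A : Set Y // A.Countable} =>
    exists_countable_approximates A.2
  let D : ℕ → {A : Set Y // A.Countable} := fun n => (fun A => ⟨F A, hF A⟩)^[n] ⟨A, hA⟩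
  have hD : ∀ n, D (n + 1) = ⟨F (D n), hF (D n)⟩ := fun n => Function.iterate_succ_apply' _ _ _
  have hmono : Monotone fun n => (D n : Set Y) := by
    refine monotone_nat_of_le_succ fun n => ?_
    rw [hD n]
    exact hsub (D n)
  have hstep : ∀ n, Approximates (D n : Set Y) (D (n + 1)) := by
    intro n
    rw [hD n]
    exact happ (D n)
  refine ⟨⋃ n, (D n : Set Y), Set.countable_iUnion fun n => (D n).2,
    Set.subset_iUnion (fun n => (D n : Set Y)) 0, ?_, ?_⟩
  · intro x hx
    rw [Submodule.span_iUnion, SetLike.mem_coe, Submodule.mem_iSup_of_directed _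
      (fun i j => ⟨max i j, Submodule.span_mono (hmono (le_max_left i j)),
        Submodule.span_mono (hmono (le_max_right i j))⟩)] at hx
    obtain ⟨n, hn⟩ := hx
    exact closure_mono (Set.subset_iUnion (fun n => (D n : Set Y)) (n + 1)) ((hstep n).1 hn)
  · intro m k b hb e η hη
    choose N hN using fun i => Set.mem_iUnion.1 (hb i)
    obtain ⟨y, hy, hyp⟩ := (hstep (Finset.univ.sup N)).2 m k b
      (fun i => hmono (Finset.le_sup (Finset.mem_univ i)) (hN i)) e η hη
    exact ⟨y, fun j => Set.mem_iUnion.2 ⟨_, hy j⟩, hyp⟩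

/-- Split `E` as `E ∩ X` plus a complement `G`. Perturb a basis `f` of `E ∩ X` to vectors `b` in
`D`, and take `y` in `D` imitating the basis `g` of `G` over `b`. The operator that is the identity
on `E ∩ X` and sends `g` to `y` is then almost isometric. -/
theorem Approximates.isAIIdeal {D : Set Y} (hD : Approximates D D) :
    IsAIIdeal (Submodule.span ℝ D).topologicalClosure := by
  set X := (Submodule.span ℝ D).topologicalClosure
  have hDX : D ⊆ X := Submodule.subset_span.trans (Submodule.le_topologicalClosure _)
  have hXD : (X : Set Y) ⊆ closure D := closure_minimal hD.1 isClosed_closure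
  intro ε hε E hE
  let F : Submodule ℝ E := X.comap E.subtype
  obtain ⟨G, hFG⟩ := F.exists_isCompl
  let β := Module.finBasis ℝ F
  let γ := Module.finBasis ℝ G
  let L : E →ₗ[ℝ] (Fin (Module.finrank ℝ F) → ℝ) × (Fin (Module.finrank ℝ G) → ℝ) :=
    (β.equivFun.toLinearMap.prodMap γ.equivFun.toLinearMap) ∘ₗ
      (Submodule.prodEquivOfIsCompl F G hFG).symm.toLinearMap
  obtain ⟨C, hC, hLC⟩ : ∃ C : ℝ, 0 < C ∧ ∀ e, ‖L e‖ ≤ C * ‖e‖ :=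
    (LinearMap.toContinuousLinearMap L).bound
  let f : Fin (Module.finrank ℝ F) → Y := fun i => (β i : E)
  let g : Fin (Module.finrank ℝ G) → Y := fun j => (γ j : E)
  have hfX : ∀ i, f i ∈ X := fun i => (β i).2
  -- Three errors of size `η * ‖L e‖` add up: replacing `f` by `b`, passing between `y` and `g`, and
  -- returning from `b` to `f`. The constant `C` bounds coordinates by the norm.
  let η : ℝ := ε / (3 * C)
  have hη : 0 < η := by positivity
  obtain ⟨b, hbD, hbf⟩ : ∃ b : Fin (Module.finrank ℝ F) → Y, (∀ i, b i ∈ D) ∧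
      ∑ i, ‖b i - f i‖ ≤ η := by
    -- The `+ 1` keeps the divisor positive when `E ∩ X` is trivial.
    let N : ℝ := Module.finrank ℝ F + 1
    have hN : 0 < N := by positivity
    have := fun i => Metric.mem_closure_iff.1 (hXD (hfX i)) (η / N) (by positivity)
    choose b hb hbf using this
    refine ⟨b, hb, ?_⟩
    calc ∑ i, ‖b i - f i‖ ≤ ∑ _i : Fin (Module.finrank ℝ F), η / N :=
          Finset.sum_le_sum fun i _ => by
            rw [← dist_eq_norm, dist_comm]
            exact (hbf i).le
      _ = Module.finrank ℝ F * (η / N) := by simp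
      _ ≤ N * (η / N) := by
          refine mul_le_mul_of_nonneg_right ?_ (by positivity)
          simp [N]
      _ = η := mul_div_cancel₀ η hN.ne'
  obtain ⟨y, hyD, hy⟩ := hD.2 _ _ b hbD g η hη
  let T : E →ₗ[ℝ] X := LinearMap.ofIsCompl hFG
    ((E.subtype ∘ₗ F.subtype).codRestrict X fun u => u.2)
    (γ.constr ℝ fun j => ⟨y j, hDX (hyD j)⟩)
  have hsplit : ∀ e : E, ∃ (u : F) (v : G), e = u + v := fun e => by
    obtain ⟨u, v, hu, hv, rfl⟩ := Submodule.codisjoint_iff_exists_add_eq.1 hFG.codisjoint e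
    exact ⟨⟨u, hu⟩, ⟨v, hv⟩, rfl⟩
  have hLuv : ∀ (u : F) (v : G), L (u + v) = (β.equivFun u, γ.equivFun v) := fun u v => by
    simp [L]
  have hβ : ∀ u : F, ((u : E) : Y) = ∑ i, β.equivFun u i • f i := fun u => by
    have := congrArg (E.subtype ∘ₗ F.subtype) (β.sum_equivFun u)
    simp only [map_sum, map_smul] at this
    exact this.symm
  have hγ : ∀ v : G, ((v : E) : Y) = ∑ j, γ.equivFun v j • g j := fun v => by
    have := congrArg (E.subtype ∘ₗ G.subtype) (γ.sum_equivFun v)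
    simp only [map_sum, map_smul] at this
    exact this.symm
  have hcomb : ∀ e : E, (e : Y) = combination f g (L e) := fun e => by
    obtain ⟨u, v, rfl⟩ := hsplit e
    rw [hLuv, combination, ← hβ, ← hγ]
    rfl
  have hT : ∀ e : E, (T e : Y) = combination f y (L e) := fun e => by
    obtain ⟨u, v, rfl⟩ := hsplit e
    rw [hLuv, combination, ← hβ, map_add, LinearMap.ofIsCompl_apply_left,
      LinearMap.ofIsCompl_apply_right, Module.Basis.constr_apply_fintype]
    simp only [Submodule.coe_add, Submodule.coe_sum, Submodule.coe_smul]
    rfl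
  have hclose : ∀ e : E, |‖T e‖ - ‖e‖| ≤ ε * ‖e‖ := fun e => by
    have h1 := (abs_norm_sub_norm_le _ _).trans (norm_combination_sub_le b f y (L e))
    have h2 := (abs_norm_sub_norm_le _ _).trans (norm_combination_sub_le b f g (L e))
    have h3 := hy (L e)
    have h4 : (∑ i, ‖b i - f i‖) * ‖L e‖ ≤ η * ‖L e‖ :=
      mul_le_mul_of_nonneg_right hbf (norm_nonneg _)
    have h5 : 3 * (η * ‖L e‖) ≤ ε * ‖e‖ := by
      calc 3 * (η * ‖L e‖) ≤ 3 * (η * (C * ‖e‖)) := by gcongr; exact hLC e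
        _ = ε * ‖e‖ := by simp only [η]; field_simp
    have hTn : ‖T e‖ = ‖combination f y (L e)‖ := by rw [← hT e]; rfl
    have hen : ‖e‖ = ‖combination f g (L e)‖ := by rw [← hcomb e]; rfl
    rw [hTn]
    rw [abs_le] at h1 h2 h3 ⊢
    constructor <;> linarith
  refine ⟨T, fun e he => ?_, fun e => ?_⟩
  · have := LinearMap.ofIsCompl_apply_left hFG
      (φ := (E.subtype ∘ₗ F.subtype).codRestrict X fun u => u.2)
      (ψ := γ.constr ℝ fun j => (⟨y j, hDX (hyD j)⟩ : X)) ⟨e, he⟩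
    exact congrArg Subtype.val this
  · have := abs_le.1 (hclose e)
    constructor <;> linarith

/-- Every countable set is contained in a separable almost isometric ideal. -/
theorem exists_separable_isAIIdeal {A : Set Y} (hA : A.Countable) :
    ∃ X : Submodule ℝ Y, IsClosed (X : Set Y) ∧ TopologicalSpace.SeparableSpace X ∧
      IsAIIdeal X ∧ A ⊆ X := by
  obtain ⟨D, hD, hAD, happ⟩ := exists_countable_approximates_self hA
  refine ⟨(Submodule.span ℝ D).topologicalClosure, Submodule.isClosed_topologicalClosure _, ?_,
    happ.isAIIdeal, hAD.trans (Submodule.subset_span.trans (Submodule.le_topologicalClosure _))⟩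
  exact (hD.isSeparable.span (R := ℝ)).closure.separableSpace

/-- Functionals of norm one restrict to functionals of norm one on some separable almost isometric
ideal. -/
theorem exists_separable_isAIIdeal_norm_restrict {κ : Type*} [Countable κ]
    (f : κ → StrongDual ℝ Y) (hf : ∀ i, ‖f i‖ = 1) :
    ∃ X : Submodule ℝ Y, IsClosed (X : Set Y) ∧ TopologicalSpace.SeparableSpace X ∧
      IsAIIdeal X ∧ ∀ i, ‖(f i).comp X.subtypeL‖ = 1 := by
  -- Once `X` contains these almost norming vectors, restricting to `X` cannot lower the norms.
  have hex : ∀ (i : κ) (n : ℕ), ∃ y : Y, (1 - 1 / ((n : ℝ) + 1)) * ‖y‖ < ‖f i y‖ := by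
    intro i n
    by_contra! hcon
    have hn : (0 : ℝ) < 1 / ((n : ℝ) + 1) := Nat.one_div_pos_of_nat
    have hn1 : 1 / ((n : ℝ) + 1) ≤ 1 := by
      rw [div_le_one (by positivity)]
      linarith [(n.cast_nonneg : (0 : ℝ) ≤ n)]
    have := (f i).opNorm_le_bound (by linarith) hcon
    rw [hf i] at this
    linarith
  choose y hy using hex
  obtain ⟨X, hXc, hXs, hX, hyX⟩ := exists_separable_isAIIdeal
    (Set.countable_range fun q : κ × ℕ => y q.1 q.2)
  refine ⟨X, hXc, hXs, hX, fun i => le_antisymm ?_ ?_⟩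
  · refine ContinuousLinearMap.opNorm_le_bound _ zero_le_one fun x => ?_
    rw [← hf i]
    exact (f i).le_opNorm x
  · have hlim : Tendsto (fun n : ℕ => 1 - 1 / ((n : ℝ) + 1)) atTop (𝓝 1) := by
      simpa using (tendsto_one_div_add_atTop_nhds_zero_nat (𝕜 := ℝ)).const_sub 1
    refine le_of_tendsto' hlim fun n => ?_
    have h := (hy i n).trans_le
      (((f i).comp X.subtypeL).le_opNorm ⟨y i n, hyX ⟨(i, n), rfl⟩⟩)
    exact (lt_of_mul_lt_mul_right h (norm_nonneg _)).le

theorem LD2P.of_forall_separable (h : ∀ X : Submodule ℝ Y, IsClosed (X : Set Y) →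
    TopologicalSpace.SeparableSpace X → IsAIIdeal X → LD2P X) : LD2P Y := by
  intro f ε hf hε
  obtain ⟨X, hXc, hXs, hX, hn⟩ :=
    exists_separable_isAIIdeal_norm_restrict (fun _ : Unit => f) fun _ => hf
  exact diam_eq_two_of_mem_subspace (slice_subset_closedBall _ _) (slice_subset_closedBall _ _)
    (fun x hx => ⟨mem_closedBall_zero_iff.2 (mem_closedBall_zero_iff.1 hx.1), hx.2⟩)
    (h X hXc hXs hX (f.comp X.subtypeL) ε (hn ()) hε)

theorem SD2P.of_forall_separable (h : ∀ X : Submodule ℝ Y, IsClosed (X : Set Y) →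
    TopologicalSpace.SeparableSpace X → IsAIIdeal X → SD2P X) : SD2P Y := by
  intro n c f ε hc hsum hf hε
  obtain ⟨X, hXc, hXs, hX, hn⟩ := exists_separable_isAIIdeal_norm_restrict f hf
  refine diam_eq_two_of_mem_subspace (sliceCombination_subset_closedBall f ε hc hsum)
    (sliceCombination_subset_closedBall _ ε hc hsum) ?_
    (h X hXc hXs hX n c (fun i => (f i).comp X.subtypeL) ε hc hsum hn hε)
  rintro _ ⟨z, hz, rfl⟩
  refine ⟨fun i => z i, fun i =>
    ⟨mem_closedBall_zero_iff.2 (mem_closedBall_zero_iff.1 (hz i).1), (hz i).2⟩, ?_⟩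
  simp

/-- No norms of functionals need preserving here: the inclusion of `X` is weakly continuous, so it
is enough that `X` contains one point of the set. -/
theorem D2P.of_forall_separable (h : ∀ X : Submodule ℝ Y, IsClosed (X : Set Y) →
    TopologicalSpace.SeparableSpace X → IsAIIdeal X → D2P X) : D2P Y := by
  intro V hV hne
  have hVball := hV.subset_closedBall
  obtain ⟨U, hU, rfl⟩ := hV
  obtain ⟨x₀, hx₀, hx₀U⟩ := hne
  obtain ⟨X, hXc, hXs, hX, hxX⟩ := exists_separable_isAIIdeal (Set.countable_singleton x₀)
  have hV' : IsRelWeaklyOpen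
      (Metric.closedBall (0 : X) 1 ∩ toWeakSpace ℝ X ⁻¹' (WeakSpace.map X.subtypeL ⁻¹' U)) :=
    ⟨_, hU.preimage (WeakSpace.map X.subtypeL).continuous, rfl⟩
  exact diam_eq_two_of_mem_subspace hVball hV'.subset_closedBall
    (fun x hx => ⟨mem_closedBall_zero_iff.2 (mem_closedBall_zero_iff.1 hx.1), hx.2⟩)
    (h X hXc hXs hX _ hV' ⟨⟨x₀, hxX rfl⟩,
      mem_closedBall_zero_iff.2 (mem_closedBall_zero_iff.1 hx₀), hx₀U⟩)

end SeparableIdeals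

end DiamTwo

theorem mainTheorem2 {Y : Type*} [NormedAddCommGroup Y] [NormedSpace ℝ Y] [CompleteSpace Y] :
    (DiamTwo.SD2P Y ↔
      ∀ X : Submodule ℝ Y, IsClosed (X : Set Y) → TopologicalSpace.SeparableSpace X →
        DiamTwo.IsAIIdeal X → DiamTwo.SD2P X) ∧
    (DiamTwo.D2P Y ↔
      ∀ X : Submodule ℝ Y, IsClosed (X : Set Y) → TopologicalSpace.SeparableSpace X →
        DiamTwo.IsAIIdeal X → DiamTwo.D2P X) ∧
    (DiamTwo.LD2P Y ↔
      ∀ X : Submodule ℝ Y, IsClosed (X : Set Y) → TopologicalSpace.SeparableSpace X →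
        DiamTwo.IsAIIdeal X → DiamTwo.LD2P X) :=
  ⟨⟨fun h _ _ _ hX => h.of_isAIIdeal hX, DiamTwo.SD2P.of_forall_separable⟩,
    ⟨fun h _ _ _ hX => h.of_isAIIdeal hX, DiamTwo.D2P.of_forall_separable⟩,
    ⟨fun h _ _ _ hX => h.of_isAIIdeal hX, DiamTwo.LD2P.of_forall_separable⟩⟩
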